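/- Let $\psi(z)=\sum_{n\ge 0} b_n z^n$ be a nonconstant power series with radius of convergence $R\in(0,\infty]$, with coefficients $b_n\ge 0$ and with $b_0>0$. For $t\in[0,R)$ let $X_t$ be a random variable with values in $\{0,1,2,\dots\}$ and $\mathbb P(X_t=n)=b_n t^n/\psi(t)$ for $n\ge 0$ (with $0^0=1$), and write $m_\psi(t)=\mathbb E(X_t)$, $\sigma_\psi^2(t)=\mathbb V(X_t)$ with $\sigma_\psi(t)\ge 0$, $M_\psi=\lim_{t\uparrow R}m_\psi(t)\in[0,\infty]$ and $Q_\psi=\gcd\{n\ge 1: b_n\neq 0\}$. Theorem (Otter--Meir--Moon). Assume that $M_\psi>1$. Then there is a unique $\tau\in(0,R)$ such that $m_\psi(\tau)=1$. Lagrange's equation $g(w)=w\,\psi(g(w))$ has a solution $g$ holomorphic in a neighbourhood of $w=0$, and any two such solutions have the same Taylor series $\sum_{n\ge 0}A_n w^n$ at $0$. Its coefficients $A_n$ are real and satisfy (a) $A_n=0$ if $n\not\equiv 1 \pmod{Q_\psi}$; (b) as $n\to\infty$ through the indices $n\equiv 1\pmod{Q_\psi}$, $$A_n\sim \frac{Q_\psi}{\sqrt{2\pi}}\,\frac{\tau}{\sigma_\psi(\tau)}\,\frac{1}{n^{3/2}}\Big(\frac{\psi(\tau)}{\tau}\Big)^n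 .$$ -/

import Mathlib

open Filter Topology Asymptotics
open scoped ENNReal

noncomputable section

namespace Khinchin

/-- The radius of convergence `R ∈ [0, ∞]` of the power series `∑ b n z ^ n`. -/
def radius (b : ℕ → ℝ) : ℝ≥0∞ :=
  (FormalMultilinearSeries.ofScalars ℂ (fun n => (b n : ℂ))).radius

/-- The class of nonconstant power series `∑ b n z ^ n` with positive radius of convergence,
nonnegative coefficients and positive constant term. -/
structure ClassK (b : ℕ → ℝ) : Prop where
  nonneg : ∀ n, 0 ≤ b n
  constantCoeff_pos : 0 < b 0
  nonconstant : ∃ n, 1 ≤ n ∧ b n ≠ 0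
  radius_pos : 0 < radius b

/-- The sum `∑ b n t ^ n` at a real point `t`. -/
def psi (b : ℕ → ℝ) (t : ℝ) : ℝ := ∑' n, b n * t ^ n

/-- The sum `∑ b n z ^ n` at a complex point `z`. -/
def psiC (b : ℕ → ℝ) (z : ℂ) : ℂ := ∑' n, (b n : ℂ) * z ^ n

/-- The mass function `P(X_t = n) = b n t ^ n / ψ(t)` of the Khinchin family of `ψ = ∑ b n z ^ n`,
for `t ∈ [0, R)`. -/
def mass (b : ℕ → ℝ) (t : ℝ) (n : ℕ) : ℝ := b n * t ^ n / psi b t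

/-- The mean `m(t) = E(X_t)`. -/
def mean (b : ℕ → ℝ) (t : ℝ) : ℝ := ∑' n : ℕ, (n : ℝ) * mass b t n

/-- The variance `σ²(t) = V(X_t) = E((X_t - m(t))²)`. -/
def variance (b : ℕ → ℝ) (t : ℝ) : ℝ := ∑' n : ℕ, ((n : ℝ) - mean b t) ^ 2 * mass b t n

/-- The standard deviation `σ(t)`. -/
def sigma (b : ℕ → ℝ) (t : ℝ) : ℝ := √(variance b t)

/-- The limit `M ∈ [0, ∞]` of the mean `m(t)` as `t ↑ R`; here `t` runs over the elements `t < R`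
of `[0, ∞]`, all of them finite, so that the cases `R < ∞` and `R = ∞` are both covered. -/
def meanLimit (b : ℕ → ℝ) : ℝ≥0∞ :=
  limUnder (𝓝[<] radius b) (fun t : ℝ≥0∞ => ENNReal.ofReal (mean b t.toReal))

/-- `Q = gcd {n ≥ 1 : b n ≠ 0}`. -/
def gcdIndex (b : ℕ → ℝ) : ℕ := Nat.setGcd {n | 1 ≤ n ∧ b n ≠ 0}

/-- `g` is holomorphic near `0` and satisfies Lagrange's equation `g(w) = w ψ(g(w))` for all `w` in a
neighbourhood of `0`. At `w = 0` the equation says `g(0) = 0`, so that `g(w)` lies in the disk of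
convergence of `ψ` for `w` near `0`. -/
structure IsLagrangeSolution (b : ℕ → ℝ) (g : ℂ → ℂ) : Prop where
  analyticAt : AnalyticAt ℂ g 0
  equation : ∀ᶠ w in 𝓝 (0 : ℂ), g w = w * psiC b (g w)

end Khinchin

end

/-!
Write `A n = [z ^ (n - 1)] ψ(z) ^ n / n`. By Lagrange inversion these are the Taylor coefficients of
every solution of `g = w ψ(g)`: expand `ψ(z) ^ n = ∑_{k < n} c k z ^ k + z ^ n h(z)` with `h` analytic
and integrate `g' / w ^ n = g' ψ(g) ^ n / g ^ n` over a small circle. The terms `g' g ^ (k - n)` with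
`k < n - 1` have primitives, `g' h(g)` is analytic, and `g' / g` contributes `2 π i` since `g` has a
simple zero at `0` (`iteratedDeriv_div_factorial_eq_coeff_of_lagrange`). A solution exists because
`z / ψ(z)` is locally invertible.

As `ψ` is a power series in `z ^ Q`, the coefficient `[z ^ (n - 1)] ψ ^ n` vanishes unless `Q` divides
`n - 1`, which is (a). For (b), the mean `m(t)` is strictly increasing (`mean_lt_mean`), so that it
takes the value `1` at exactly one `τ`. Cauchy's formula on the circle of radius `τ` gives
`n A n = ψ(τ) ^ n τ ^ (1 - n) P(S_n = n - 1)`, where `S_n` is a sum of `n` independent copies of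
`X_τ`, a variable of mean `1` and variance `σ²`; the probability appears as the Fourier integral of
`Φ(θ) ^ n e ^ (i θ)`, with `Φ` the characteristic function of `X_τ - 1`. On `[-π / Q, π / Q]` the
bound `|Φ(θ)| ≤ exp (-c θ²)` holds (`exists_norm_centredCharFun_le_exp`): near the origin by Taylor's
formula, and elsewhere by compactness, because `|Φ(θ)| = 1` would force `exp (i Q θ) = 1`. Dominated
convergence after `θ = x / √n` then gives the Gaussian limit
(`tendsto_sqrt_mul_integral_centredCharFun`), and by periodicity the whole circle contributes `Q`
times as much as the interval.
-/

/-! ### Lagrange inversion -/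

/-- Taylor's formula with the remainder given by the iterated slope at the centre. -/
theorem HasFPowerSeriesAt.eq_sum_add_pow_mul_iterate_dslope {f : ℂ → ℂ}
    {p : FormalMultilinearSeries ℂ ℂ ℂ} (hp : HasFPowerSeriesAt f p 0) (n : ℕ) (z : ℂ) :
    f z = ∑ k ∈ Finset.range n, p.coeff k * z ^ k +
      z ^ n * ((Function.swap dslope 0)^[n] f) z := by
  induction n with
  | zero => simp
  | succ n ih =>
    have h0 : ((Function.swap dslope 0)^[n] f) 0 = p.coeff n := by
      have h := (hp.has_fpower_series_iterate_dslope_fslope n).coeff_zero 1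
      have h2 : (FormalMultilinearSeries.fslope^[n] p).coeff 0 = p.coeff (0 + n) := by
        simp [FormalMultilinearSeries.coeff_iterate_fslope]
      rw [zero_add] at h2
      rw [← h, ← h2]
      rfl
    have h1 := sub_smul_dslope ((Function.swap dslope 0)^[n] f) 0 z
    rw [h0, smul_eq_mul, sub_zero] at h1
    rw [ih, Finset.sum_range_succ, Function.iterate_succ_apply', pow_succ]
    change _ = _ + _ + _ * z * dslope ((Function.swap dslope 0)^[n] f) 0 z
    linear_combination (-z ^ n) * h1

/-- Cauchy's formula for the Taylor coefficients at `0`. -/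
theorem HasFPowerSeriesAt.coeff_eq_circleIntegral {f : ℂ → ℂ}
    {p : FormalMultilinearSeries ℂ ℂ ℂ} (hp : HasFPowerSeriesAt f p 0) {r : ℝ} (hr : 0 < r)
    (hf : DifferentiableOn ℂ f (Metric.closedBall 0 r)) (n : ℕ) :
    p.coeff n = (2 * Real.pi * Complex.I)⁻¹ * ∮ z in C(0, r), (z ^ (n + 1))⁻¹ * f z := by
  lift r to NNReal using hr.le
  have h := (hf.hasFPowerSeriesOnBall (by exact_mod_cast hr)).hasFPowerSeriesAt
  rw [hp.eq_formalMultilinearSeries h]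
  have h2 := cauchyPowerSeries_apply f 0 r n 1
  have h3 : (cauchyPowerSeries f 0 r).coeff n = (cauchyPowerSeries f 0 r n) fun _ => 1 := rfl
  rw [h3, h2, smul_eq_mul]
  congr 2
  funext z
  simp only [sub_zero, smul_eq_mul, one_div, inv_pow, pow_succ, mul_inv]
  ring

/-- **Lagrange inversion**: if `g = w φ(g)` near `0`, then `n [w ^ n] g = [z ^ (n - 1)] φ ^ n`. -/
theorem iteratedDeriv_div_factorial_eq_coeff_of_lagrange {φ g : ℂ → ℂ} (hφ : AnalyticAt ℂ φ 0)
    (hφ0 : φ 0 ≠ 0) (hg : AnalyticAt ℂ g 0) (heq : ∀ᶠ w in 𝓝 (0 : ℂ), g w = w * φ (g w))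
    {m : ℕ} {c : FormalMultilinearSeries ℂ ℂ ℂ}
    (hc : HasFPowerSeriesAt (fun z => φ z ^ (m + 1)) c 0) :
    iteratedDeriv (m + 1) g 0 / (m.factorial : ℂ) = c.coeff m := by
  have hg0 : g 0 = 0 := by simpa using heq.self_of_nhds
  set h : ℂ → ℂ := (Function.swap dslope 0)^[m + 1] (fun z => φ z ^ (m + 1)) with hh
  have hhan : AnalyticAt ℂ h 0 := (hc.has_fpower_series_iterate_dslope_fslope (m + 1)).analyticAt
  have hexp := hc.eq_sum_add_pow_mul_iterate_dslope (m + 1)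
  -- the factor `u` in `g = w u` does not vanish near `0`
  set u : ℂ → ℂ := fun w => φ (g w) with hu
  have huan : AnalyticAt ℂ u 0 := by
    apply AnalyticAt.fun_comp _ hg
    rwa [hg0]
  have hhgan : AnalyticAt ℂ (fun w => h (g w)) 0 := by
    apply AnalyticAt.fun_comp _ hg
    rwa [hg0]
  have hu0 : ∀ᶠ w in 𝓝 (0 : ℂ), u w ≠ 0 :=
    huan.continuousAt.eventually_ne (by simpa [hu, hg0] using hφ0)
  obtain ⟨r, hr, hball⟩ := Metric.nhds_basis_closedBall.eventually_iff.1
    ((hg.eventually_analyticAt.and huan.eventually_analyticAt).and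
      ((hhgan.eventually_analyticAt.and hu0).and heq.eventually_nhds))
  have hsph : ∀ {w : ℂ}, w ∈ Metric.sphere (0 : ℂ) r → w ∈ Metric.closedBall (0 : ℂ) r ∧ w ≠ 0 :=
    fun {w} hw => ⟨Metric.sphere_subset_closedBall hw, fun h0 => by
      subst h0; simp at hw; exact hr.ne hw⟩
  have hdg : HasFPowerSeriesAt (deriv g) _ 0 := hg.deriv.hasFPowerSeriesAt
  have hdiff : DifferentiableOn ℂ (deriv g) (Metric.closedBall 0 r) := fun w hw =>
    (hball hw).1.1.deriv.differentiableAt.differentiableWithinAt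
  have hcoef := hdg.coeff_eq_circleIntegral hr hdiff m
  rw [FormalMultilinearSeries.coeff_ofScalars, ← iteratedDeriv_succ'] at hcoef
  rw [hcoef]
  -- on the circle `g' / w ^ (m + 1) = c m / w + E + D`, with `E` analytic inside and `D` a derivative
  set E : ℂ → ℂ := fun w => c.coeff m * (deriv u w / u w) + deriv g w * h (g w) with hE
  have hEdiff : ∀ w ∈ Metric.closedBall (0 : ℂ) r, DifferentiableAt ℂ E w := by
    intro w hw
    obtain ⟨⟨h1, h2⟩, ⟨h3, h4⟩, h5⟩ := hball hw
    exact ((h2.deriv.differentiableAt.div h2.differentiableAt h4).const_mul _).add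
      (h1.deriv.differentiableAt.mul h3.differentiableAt)
  have hEint : (∮ w in C(0, r), E w) = 0 :=
    Complex.circleIntegral_eq_zero_of_differentiable_on_off_countable hr.le
      Set.countable_empty (fun w hw => (hEdiff w hw).continuousAt.continuousWithinAt)
      (fun w hw => hEdiff w (Metric.ball_subset_closedBall hw.1))
  set D : ℂ → ℂ := fun w => ∑ k ∈ Finset.range m,
    c.coeff k * (g w ^ ((k : ℤ) - m - 1) * deriv g w) with hD
  have hDint : (∮ w in C(0, r), D w) = 0 := by
    apply circleIntegral.integral_eq_zero_of_hasDerivWithinAt'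
      (f := fun w => ∑ k ∈ Finset.range m,
        c.coeff k * (((k : ℂ) - m)⁻¹ * g w ^ ((k : ℤ) - m)))
    rw [abs_of_pos hr]
    intro w hw
    obtain ⟨hw, hw0⟩ := hsph hw
    obtain ⟨⟨h1, h2⟩, ⟨h3, h4⟩, h5⟩ := hball hw
    have hgw : g w ≠ 0 := by rw [h5.self_of_nhds]; exact mul_ne_zero hw0 h4
    apply HasDerivAt.hasDerivWithinAt
    apply HasDerivAt.fun_sum
    intro k hk
    have hkm : (k : ℂ) - m ≠ 0 := by
      rw [sub_ne_zero]; exact_mod_cast (Finset.mem_range.1 hk).ne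
    have hz := (hasDerivAt_zpow ((k : ℤ) - m) (g w) (Or.inl hgw)).comp w
      h1.differentiableAt.hasDerivAt
    have := (hz.const_mul (((k : ℂ) - m)⁻¹)).const_mul (c.coeff k)
    refine this.congr_deriv ?_
    push_cast
    rw [mul_assoc ((k : ℂ) - m), inv_mul_cancel_left₀ hkm]
  have hkey : ∀ w ∈ Metric.sphere (0 : ℂ) r,
      (w ^ (m + 1))⁻¹ * deriv g w - c.coeff m * w⁻¹ - E w = D w := by
    intro w hw
    obtain ⟨hw, hw0⟩ := hsph hw
    obtain ⟨⟨h1, h2⟩, ⟨h3, h4⟩, h5⟩ := hball hw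
    have hgw : g w = w * u w := h5.self_of_nhds
    have hgw0 : g w ≠ 0 := by rw [hgw]; exact mul_ne_zero hw0 h4
    have hder : deriv g w = u w + w * deriv u w := by
      have hd := (hasDerivAt_id w).mul h2.differentiableAt.hasDerivAt
      rw [Filter.EventuallyEq.deriv_eq h5]
      have := hd.deriv
      simp only [id_eq, one_mul] at this
      exact this
    have hexpw := hexp (g w)
    change u w ^ (m + 1) = _ + g w ^ (m + 1) * h (g w) at hexpw
    rw [Finset.sum_range_succ] at hexpw
    have hw1 : (w ^ (m + 1))⁻¹ = u w ^ (m + 1) * (g w ^ (m + 1))⁻¹ := by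
      rw [hgw, mul_pow, mul_inv]
      field_simp
    have hDw : D w = (∑ k ∈ Finset.range m, c.coeff k * g w ^ k) * (g w ^ (m + 1))⁻¹ *
        deriv g w := by
      rw [hD, Finset.sum_mul, Finset.sum_mul]
      refine Finset.sum_congr rfl fun k _ => ?_
      rw [sub_sub, zpow_sub₀ hgw0]
      norm_cast
      field_simp
    have hgg : deriv g w = g w * (w⁻¹ + deriv u w / u w) := by
      rw [hder, hgw]; field_simp
    have hcancel : (g w) ^ (m + 1) * (g w ^ (m + 1))⁻¹ = 1 := mul_inv_cancel₀ (pow_ne_zero _ hgw0)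
    have hcancel' : g w ^ m * (g w ^ (m + 1))⁻¹ * g w = 1 := by rw [← hcancel]; ring
    rw [hDw, hw1, hexpw, hE]
    linear_combination (h (g w) * deriv g w) * hcancel +
      (c.coeff m * g w ^ m * (g w ^ (m + 1))⁻¹) * hgg +
      (c.coeff m * (w⁻¹ + deriv u w / u w)) * hcancel'
  have hcont1 : ContinuousOn (fun w : ℂ => (w ^ (m + 1))⁻¹ * deriv g w) (Metric.sphere 0 r) := by
    refine ContinuousOn.mul (ContinuousOn.inv₀ (by fun_prop) fun w hw =>
      pow_ne_zero _ (hsph hw).2) (hdiff.continuousOn.mono Metric.sphere_subset_closedBall)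
  have hcont2 : ContinuousOn (fun w : ℂ => c.coeff m * w⁻¹) (Metric.sphere 0 r) :=
    continuousOn_const.mul (continuousOn_id.inv₀ fun w hw => (hsph hw).2)
  have hcont3 : ContinuousOn E (Metric.sphere 0 r) := fun w hw =>
    (hEdiff w (hsph hw).1).continuousAt.continuousWithinAt
  have hI := circleIntegral.integral_congr hr.le hkey
  have hsub := circleIntegral.integral_sub ((hcont1.sub hcont2).circleIntegrable hr.le)
    (hcont3.circleIntegrable hr.le)
  have hsub' := circleIntegral.integral_sub (hcont1.circleIntegrable hr.le)
    (hcont2.circleIntegrable hr.le)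
  simp only [Pi.sub_apply] at hsub
  rw [hDint, hsub, hEint, sub_zero, hsub', circleIntegral.integral_const_mul] at hI
  have h1 := circleIntegral.integral_sub_center_inv (0 : ℂ) hr.ne'
  simp only [sub_zero] at h1
  rw [h1, sub_eq_zero] at hI
  rw [hI]
  field_simp [Complex.two_pi_I_ne_zero]

/-- Lagrange's equation has an analytic solution, the local inverse of `z / φ(z)`. -/
theorem exists_analyticAt_lagrange {φ : ℂ → ℂ} (hφ : AnalyticAt ℂ φ 0) (hφ0 : φ 0 ≠ 0) :
    ∃ g : ℂ → ℂ, AnalyticAt ℂ g 0 ∧ ∀ᶠ w in 𝓝 (0 : ℂ), g w = w * φ (g w) := by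
  set f : ℂ → ℂ := fun z => z / φ z with hf
  have hfan : AnalyticAt ℂ f 0 := analyticAt_id.div hφ hφ0
  have hd : deriv f 0 ≠ 0 := by
    have := ((hasDerivAt_id (0 : ℂ)).div hφ.differentiableAt.hasDerivAt hφ0).deriv
    change deriv f 0 = _ at this
    rw [this]
    simp [hφ0]
  have hf0 : f 0 = 0 := by simp [hf]
  set g := hfan.hasStrictDerivAt.localInverse _ _ _ hd with hgdef
  have hgan : AnalyticAt ℂ g 0 := by simpa [hf0] using hfan.analyticAt_localInverse hd
  have hg0 : g 0 = 0 := by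
    have h := hfan.hasStrictDerivAt.eventually_left_inverse hd |>.self_of_nhds
    rwa [hf0] at h
  have hinv : ∀ᶠ w in 𝓝 (0 : ℂ), f (g w) = w := by
    have h := hfan.hasStrictDerivAt.eventually_right_inverse hd
    rwa [hf0] at h
  have hne : ∀ᶠ w in 𝓝 (0 : ℂ), φ (g w) ≠ 0 := by
    have : ContinuousAt (fun w => φ (g w)) 0 := by
      apply ContinuousAt.comp' _ hgan.continuousAt
      rw [hg0]; exact hφ.continuousAt
    exact this.eventually_ne (by rwa [hg0])
  refine ⟨g, hgan, ?_⟩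
  filter_upwards [hinv, hne] with w h1 h2
  nth_rewrite 2 [← h1]
  simp only [hf]
  field_simp

namespace Khinchin

variable {b : ℕ → ℝ} {s t : ℝ}

/-! ### The power series and its powers -/

/-- Inside the disk of convergence all the moments converge. -/
theorem summable_pow_mul_radius (k : ℕ) (ht0 : 0 ≤ t) (ht : ENNReal.ofReal t < radius b) :
    Summable fun n : ℕ => (n : ℝ) ^ k * |b n * t ^ n| := by
  obtain ⟨r, htr, hr⟩ := ENNReal.lt_iff_exists_nnreal_btwn.1 ht
  have htr' : t < r := by
    rw [ENNReal.ofReal, ENNReal.coe_lt_coe] at htr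
    exact (Real.toNNReal_lt_iff_lt_coe ht0).1 htr
  have hr0 : (0 : ℝ) < r := ht0.trans_lt htr'
  obtain ⟨C, hC, h⟩ := FormalMultilinearSeries.norm_mul_pow_le_of_lt_radius _ hr
  have hq : ‖t / r‖ < 1 := by
    rw [Real.norm_of_nonneg (by positivity), div_lt_one hr0]; exact htr'
  refine Summable.of_nonneg_of_le (fun n => by positivity) (fun n => ?_)
    ((summable_pow_mul_geometric_of_norm_lt_one k hq).mul_left C)
  have hn := h n
  rw [FormalMultilinearSeries.ofScalars_norm, Complex.norm_real, Real.norm_eq_abs] at hn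
  have e : |b n * t ^ n| = (|b n| * r ^ n) * (t / r) ^ n := by
    rw [abs_mul, abs_of_nonneg (pow_nonneg ht0 n), div_pow]
    field_simp
  rw [e]
  calc (n : ℝ) ^ k * ((|b n| * r ^ n) * (t / r) ^ n) ≤ (n : ℝ) ^ k * (C * (t / r) ^ n) := by
        gcongr
    _ = _ := by ring

theorem summable_norm_psiC {z : ℂ} (hz : ENNReal.ofReal ‖z‖ < radius b) :
    Summable fun n => ‖(b n : ℂ) * z ^ n‖ := by
  refine (summable_pow_mul_radius 0 (norm_nonneg z) hz).congr fun n => ?_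
  simp [abs_mul]

/-- The coefficient of `z ^ k` in `ψ(z) ^ n`, read off from the formal power. -/
noncomputable def powCoeff (b : ℕ → ℝ) (n k : ℕ) : ℝ :=
  PowerSeries.coeff k (PowerSeries.mk b ^ n)

theorem powCoeff_succ (n k : ℕ) : powCoeff b (n + 1) k =
    ∑ p ∈ Finset.HasAntidiagonal.antidiagonal k, powCoeff b n p.1 * b p.2 := by
  simp [powCoeff, pow_succ, PowerSeries.coeff_mul]

theorem hasSum_powCoeff {z : ℂ} (hz : ENNReal.ofReal ‖z‖ < radius b) (n : ℕ) :
    (Summable fun k => ‖(powCoeff b n k : ℂ) * z ^ k‖) ∧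
      HasSum (fun k => (powCoeff b n k : ℂ) * z ^ k) (psiC b z ^ n) := by
  induction n with
  | zero =>
    have h0 : ∀ k ≠ 0, (powCoeff b 0 k : ℂ) * z ^ k = 0 := fun k hk => by
      simp [powCoeff, PowerSeries.coeff_one, hk]
    refine ⟨summable_of_ne_finset_zero (s := {0}) fun k hk => ?_, ?_⟩
    · rw [h0 k (by simpa using hk), norm_zero]
    · convert hasSum_single 0 h0 using 1
      simp [powCoeff]
  | succ n ih =>
    have hterm : ∀ k, (powCoeff b (n + 1) k : ℂ) * z ^ k = ∑ p ∈ Finset.HasAntidiagonal.antidiagonal k,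
        ((powCoeff b n p.1 : ℂ) * z ^ p.1) * ((b p.2 : ℂ) * z ^ p.2) := fun k => by
      rw [powCoeff_succ]
      push_cast
      rw [Finset.sum_mul]
      refine Finset.sum_congr rfl fun p hp => ?_
      rw [← Finset.HasAntidiagonal.mem_antidiagonal.1 hp, pow_add]
      ring
    have hs := summable_norm_psiC hz
    have hS := summable_norm_sum_mul_antidiagonal_of_summable_norm ih.1 hs
    simp only [hterm]
    refine ⟨hS, ?_⟩
    have := hS.of_norm.hasSum
    rwa [← tsum_mul_tsum_eq_tsum_sum_antidiagonal_of_summable_norm ih.1 hs, ih.2.tsum_eq] at this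

theorem hasFPowerSeriesAt_psiC_pow (hb : ClassK b) (n : ℕ) :
    HasFPowerSeriesAt (fun z => psiC b z ^ n)
      (FormalMultilinearSeries.ofScalars ℂ fun k => (powCoeff b n k : ℂ)) 0 := by
  rw [hasFPowerSeriesAt_iff]
  obtain ⟨r, hr0, hr⟩ := ENNReal.lt_iff_exists_nnreal_btwn.1 hb.radius_pos
  filter_upwards [Metric.ball_mem_nhds (0 : ℂ) (ε := r) (by exact_mod_cast hr0)] with z hz
  have hz' : ENNReal.ofReal ‖z‖ < radius b := by
    refine lt_trans ?_ hr
    rw [ENNReal.ofReal, ENNReal.coe_lt_coe]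
    exact (Real.toNNReal_lt_iff_lt_coe (norm_nonneg z)).2 (by simpa using hz)
  simpa [FormalMultilinearSeries.coeff_ofScalars, mul_comm] using (hasSum_powCoeff hz' n).2

theorem differentiableOn_psiC (hb : ClassK b) (ht : ENNReal.ofReal t < radius b) :
    DifferentiableOn ℂ (psiC b) (Metric.closedBall 0 t) := by
  have h := (FormalMultilinearSeries.ofScalars ℂ fun n => (b n : ℂ)).hasFPowerSeriesOnBall
    hb.radius_pos
  have he : (FormalMultilinearSeries.ofScalars ℂ fun n => (b n : ℂ)).sum = psiC b := by
    funext z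
    have := FormalMultilinearSeries.ofScalars_sum_eq (E := ℂ) (fun n => (b n : ℂ)) z
    simp only [smul_eq_mul] at this
    exact this
  rw [he] at h
  refine h.differentiableOn.mono fun z hz => ?_
  rw [Metric.mem_eball, edist_zero_right, ← ofReal_norm]
  exact (ENNReal.ofReal_le_ofReal (by simpa using hz)).trans_lt ht

/-- Only powers of `z ^ Q` occur in `ψ(z) ^ n`. -/
theorem powCoeff_eq_zero_of_not_dvd (n : ℕ) {k : ℕ} (hk : ¬ gcdIndex b ∣ k) :
    powCoeff b n k = 0 := by
  induction n generalizing k with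
  | zero =>
    have : k ≠ 0 := fun h => hk (h ▸ dvd_zero _)
    simp [powCoeff, PowerSeries.coeff_one, this]
  | succ n ih =>
    rw [powCoeff_succ]
    refine Finset.sum_eq_zero fun p hp => ?_
    by_cases h1 : gcdIndex b ∣ p.1
    · have h2 : ¬ gcdIndex b ∣ p.2 := fun h2 =>
        hk (Finset.HasAntidiagonal.mem_antidiagonal.1 hp ▸ dvd_add h1 h2)
      have h3 : b p.2 = 0 := by
        by_contra h3
        refine h2 (Nat.setGcd_dvd_of_mem ⟨Nat.one_le_iff_ne_zero.2 fun h => ?_, h3⟩)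
        exact h2 (h ▸ dvd_zero _)
      rw [h3, mul_zero]
    · rw [ih h1, zero_mul]

theorem gcdIndex_pos (hb : ClassK b) : 0 < gcdIndex b := by
  obtain ⟨n, hn, hbn⟩ := hb.nonconstant
  exact Nat.pos_of_dvd_of_pos (Nat.setGcd_dvd_of_mem ⟨hn, hbn⟩) hn

/-! ### The mean of the Khinchin family -/

theorem summable_pow_mul_coeff (hb : ClassK b) (k : ℕ) (ht0 : 0 ≤ t)
    (ht : ENNReal.ofReal t < radius b) : Summable fun n : ℕ => (n : ℝ) ^ k * (b n * t ^ n) := by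
  refine (summable_pow_mul_radius k ht0 ht).congr fun n => ?_
  rw [abs_of_nonneg (mul_nonneg (hb.nonneg n) (pow_nonneg ht0 n))]

theorem summable_coeff (hb : ClassK b) (ht0 : 0 ≤ t)
    (ht : ENNReal.ofReal t < radius b) : Summable fun n : ℕ => b n * t ^ n := by
  simpa using summable_pow_mul_coeff hb 0 ht0 ht

theorem psi_pos (hb : ClassK b) (ht0 : 0 ≤ t) (ht : ENNReal.ofReal t < radius b) :
    0 < psi b t := by
  refine (summable_coeff hb ht0 ht).tsum_pos
    (fun n => mul_nonneg (hb.nonneg n) (pow_nonneg ht0 n)) 0 ?_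
  simpa using hb.constantCoeff_pos

theorem mass_nonneg (hb : ClassK b) (ht0 : 0 ≤ t) (ht : ENNReal.ofReal t < radius b) (n : ℕ) :
    0 ≤ mass b t n :=
  div_nonneg (mul_nonneg (hb.nonneg n) (pow_nonneg ht0 n)) (psi_pos hb ht0 ht).le

theorem hasSum_mass (hb : ClassK b) (ht0 : 0 ≤ t) (ht : ENNReal.ofReal t < radius b) :
    HasSum (mass b t) 1 := by
  have h := (summable_coeff hb ht0 ht).hasSum.div_const (psi b t)
  change HasSum (mass b t) (psi b t / psi b t) at h
  rwa [div_self (psi_pos hb ht0 ht).ne'] at h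

theorem summable_pow_mul_mass (hb : ClassK b) (k : ℕ) (ht0 : 0 ≤ t)
    (ht : ENNReal.ofReal t < radius b) : Summable fun n : ℕ => (n : ℝ) ^ k * mass b t n := by
  refine ((summable_pow_mul_coeff hb k ht0 ht).div_const (psi b t)).congr fun n => ?_
  rw [mass, mul_div_assoc]

theorem hasSum_mul_mass (hb : ClassK b) (ht0 : 0 ≤ t) (ht : ENNReal.ofReal t < radius b) :
    HasSum (fun n : ℕ => (n : ℝ) * mass b t n) (mean b t) := by
  have := summable_pow_mul_mass hb 1 ht0 ht
  simp only [pow_one] at this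
  exact this.hasSum

/-- The centred first moment, up to the factor `ψ(t)`, is a power series in `t`. -/
theorem hasSum_sub_mul_coeff (hb : ClassK b) (c : ℝ) (ht0 : 0 ≤ t)
    (ht : ENNReal.ofReal t < radius b) :
    HasSum (fun n : ℕ => ((n : ℝ) - c) * (b n * t ^ n)) (psi b t * (mean b t - c)) := by
  have h := ((hasSum_mul_mass hb ht0 ht).sub ((hasSum_mass hb ht0 ht).mul_left c)).mul_left
    (psi b t)
  rw [mul_one] at h
  refine h.congr_fun fun n => ?_
  have := (psi_pos hb ht0 ht).ne'
  rw [mass]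
  field_simp

theorem mean_pos (hb : ClassK b) (ht0 : 0 < t) (ht : ENNReal.ofReal t < radius b) :
    0 < mean b t := by
  obtain ⟨n, hn, hbn⟩ := hb.nonconstant
  refine (hasSum_mul_mass hb ht0.le ht).summable.tsum_pos
    (fun k => mul_nonneg k.cast_nonneg (mass_nonneg hb ht0.le ht k)) n ?_
  have h1 : 0 < b n := (hb.nonneg n).lt_of_ne' hbn
  have h2 : (0 : ℝ) < n := by exact_mod_cast hn
  have := psi_pos hb ht0.le ht
  rw [mass]
  positivity

/-- The mean is strictly increasing. With `c = m(s)` and `r = t / s > 1`, the sum of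
`(n - c) (r ^ n - r ^ c) b n s ^ n` has no negative term and equals `ψ(t) (m(t) - c)`. -/
theorem mean_lt_mean (hb : ClassK b) (hs : 0 < s) (hst : s < t)
    (ht : ENNReal.ofReal t < radius b) : mean b s < mean b t := by
  have hs' : ENNReal.ofReal s < radius b := (ENNReal.ofReal_le_ofReal hst.le).trans_lt ht
  have ht0 : 0 < t := hs.trans hst
  set c := mean b s with hc
  have hcpos : 0 < c := mean_pos hb hs hs'
  set r := t / s with hr
  have hr1 : 1 < r := (one_lt_div hs).2 hst
  have h := (hasSum_sub_mul_coeff hb c ht0.le ht).sub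
    ((hasSum_sub_mul_coeff hb c hs.le hs').mul_left (r ^ c))
  rw [← hc, sub_self, mul_zero, mul_zero, sub_zero] at h
  have hterm : ∀ n : ℕ, ((n : ℝ) - c) * (b n * t ^ n) - r ^ c * (((n : ℝ) - c) * (b n * s ^ n)) =
      ((n : ℝ) - c) * (r ^ (n : ℝ) - r ^ c) * (b n * s ^ n) := fun n => by
    have : t ^ n = r ^ (n : ℝ) * s ^ n := by
      rw [Real.rpow_natCast, ← mul_pow, hr, div_mul_cancel₀ _ hs.ne']
    rw [this]; ring
  simp only [hterm] at h
  have hpos : 0 < ∑' n : ℕ, ((n : ℝ) - c) * (r ^ (n : ℝ) - r ^ c) * (b n * s ^ n) := by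
    refine h.summable.tsum_pos (fun n => mul_nonneg ?_
      (mul_nonneg (hb.nonneg n) (pow_nonneg hs.le n))) 0 ?_
    · rcases le_total (n : ℝ) c with hn | hn
      · exact mul_nonneg_of_nonpos_of_nonpos (sub_nonpos.2 hn)
          (sub_nonpos.2 (Real.rpow_le_rpow_of_exponent_le hr1.le hn))
      · exact mul_nonneg (sub_nonneg.2 hn)
          (sub_nonneg.2 (Real.rpow_le_rpow_of_exponent_le hr1.le hn))
    · have h1 : 1 < r ^ c := Real.one_lt_rpow hr1 hcpos
      have := hb.constantCoeff_pos
      simp only [CharP.cast_eq_zero, zero_sub, Real.rpow_zero, pow_zero, mul_one]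
      exact mul_pos (mul_pos_of_neg_of_neg (by linarith) (by linarith)) this
  rw [h.tsum_eq] at hpos
  have := (pos_iff_pos_of_mul_pos hpos).1 (psi_pos hb ht0.le ht)
  linarith

/-- As the mean is monotone, its limit at the radius of convergence exists and is the supremum, so
that the limit exceeds `1` only if the mean does. -/
theorem exists_one_lt_mean (hb : ClassK b) (hM : 1 < meanLimit b) :
    ∃ t : ℝ, 0 < t ∧ ENNReal.ofReal t < radius b ∧ 1 < mean b t := by
  have hmono : MonotoneOn (fun t : ℝ≥0∞ => ENNReal.ofReal (mean b t.toReal))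
      (Set.Iio (radius b)) := by
    intro x hx y hy hxy
    have hxt : x ≠ ⊤ := (lt_of_lt_of_le hx le_top).ne
    have hyt : y ≠ ⊤ := (lt_of_lt_of_le hy le_top).ne
    rcases hxy.eq_or_lt with rfl | hlt
    · exact le_rfl
    rcases eq_or_ne x 0 with rfl | hx0
    · have : mean b 0 = 0 := by
        rw [mean, ← tsum_zero (α := ℝ) (β := ℕ)]
        refine tsum_congr fun n => ?_
        rcases eq_or_ne n 0 with rfl | hn <;> simp [mass, *]
      simp [this]
    · refine ENNReal.ofReal_le_ofReal (mean_lt_mean hb (ENNReal.toReal_pos hx0 hxt)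
        ((ENNReal.toReal_lt_toReal hxt hyt).2 hlt) ?_).le
      rwa [ENNReal.ofReal_toReal hyt]
  have : (𝓝[<] radius b).NeBot := nhdsLT_neBot_of_exists_lt ⟨0, hb.radius_pos⟩
  have hlim := (hmono.tendsto_nhdsLT (OrderTop.bddAbove _)).limUnder_eq
  rw [meanLimit, hlim] at hM
  obtain ⟨_, ⟨x, hx, rfl⟩, h1⟩ := lt_sSup_iff.1 hM
  have hxt : x ≠ ⊤ := (lt_of_lt_of_le hx le_top).ne
  have h1' : 1 < mean b x.toReal := by simpa using h1
  refine ⟨x.toReal, ENNReal.toReal_nonneg.lt_of_ne' fun h0 => ?_, ?_, h1'⟩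
  · rw [h0, mean] at h1'
    have : ∀ n : ℕ, (n : ℝ) * mass b 0 n = 0 := fun n => by
      rcases eq_or_ne n 0 with rfl | hn <;> simp [mass, *]
    simp only [this, tsum_zero] at h1'
    linarith
  · rwa [ENNReal.ofReal_toReal hxt]

theorem exists_mean_eq_one (hb : ClassK b) (hM : 1 < meanLimit b) :
    ∃ τ : ℝ, 0 < τ ∧ ENNReal.ofReal τ < radius b ∧ mean b τ = 1 := by
  obtain ⟨t, ht0, ht, h1⟩ := exists_one_lt_mean hb hM
  -- `G = ψ (m - 1)` is continuous, negative at `0` and positive at `t`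
  set G : ℝ → ℝ := fun x => ∑' n : ℕ, ((n : ℝ) - 1) * (b n * x ^ n) with hG
  have hlt : ∀ {x}, x ≤ t → ENNReal.ofReal x < radius b := fun hx =>
    (ENNReal.ofReal_le_ofReal hx).trans_lt ht
  have hGval : ∀ {x}, 0 ≤ x → x ≤ t → G x = psi b x * (mean b x - 1) := fun hx0 hx =>
    (hasSum_sub_mul_coeff hb 1 hx0 (hlt hx)).tsum_eq
  have hcont : ContinuousOn G (Set.Icc 0 t) := by
    refine continuousOn_tsum (fun n => by fun_prop)
      (hasSum_sub_mul_coeff hb 1 ht0.le ht).summable.norm fun n x hx => ?_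
    rw [norm_mul _ (b n * x ^ n), norm_mul _ (b n * t ^ n),
      Real.norm_of_nonneg (mul_nonneg (hb.nonneg n) (pow_nonneg hx.1 n)),
      Real.norm_of_nonneg (mul_nonneg (hb.nonneg n) (pow_nonneg ht0.le n))]
    have := hb.nonneg n
    have := pow_le_pow_left₀ hx.1 hx.2 n
    gcongr
  have hG0 : G 0 < 0 := by
    have h : HasSum (fun n : ℕ => ((n : ℝ) - 1) * (b n * 0 ^ n)) (((0 : ℕ) - 1 : ℝ) * (b 0 * 0 ^ 0)) :=
      hasSum_single 0 fun n hn => by simp [hn]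
    rw [hG]
    simp only
    rw [h.tsum_eq]
    simpa using hb.constantCoeff_pos
  have hGt : 0 < G t := by
    rw [hGval ht0.le le_rfl]
    exact mul_pos (psi_pos hb ht0.le ht) (by linarith)
  obtain ⟨τ, hτ, hτ0⟩ := intermediate_value_Ioo ht0.le hcont ⟨hG0, hGt⟩
  refine ⟨τ, hτ.1, hlt hτ.2.le, ?_⟩
  rw [hGval hτ.1.le hτ.2.le] at hτ0
  have := (mul_eq_zero.1 hτ0).resolve_left (psi_pos hb hτ.1.le (hlt hτ.2.le)).ne'
  linarith

end Khinchin

namespace Khinchin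

variable {p : ℕ → ℝ}

/-! ### A local limit theorem for lattice variables of mean one -/

/-- The characteristic function of `X - 1`, where `P(X = k) = p k`. -/
noncomputable def centredCharFun (p : ℕ → ℝ) (θ : ℝ) : ℂ :=
  ∑' k : ℕ, (p k : ℂ) * Complex.exp ((((k : ℝ) - 1) * θ : ℝ) * Complex.I)

/-- The second order Taylor remainder of `exp (i y)`, bounded for all real `y`. -/
theorem norm_exp_mul_I_sub_taylor_le (y : ℝ) :
    ‖Complex.exp (y * Complex.I) - 1 - y * Complex.I + (y : ℂ) ^ 2 / 2‖ ≤ 4 * |y| ^ 3 := by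
  rcases le_total |y| 1 with hy | hy
  · have h := Complex.norm_exp_sub_sum_le_norm_mul_exp (y * Complex.I) 3
    have h1 : ‖(y : ℂ) * Complex.I‖ = |y| := by simp
    rw [h1] at h
    have h2 : Complex.exp (y * Complex.I) - 1 - y * Complex.I + (y : ℂ) ^ 2 / 2 =
        Complex.exp (y * Complex.I) -
          ∑ m ∈ Finset.range 3, (y * Complex.I) ^ m / (m.factorial : ℂ) := by
      simp only [Finset.sum_range_succ, Finset.sum_range_zero, Nat.factorial, mul_pow,
        Complex.I_sq]
      push_cast
      ring
    rw [h2]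
    have h3 : Real.exp |y| ≤ 4 := by
      have := Real.exp_one_lt_d9
      have := Real.exp_le_exp.2 hy
      linarith
    calc _ ≤ |y| ^ 3 * Real.exp |y| := h
      _ ≤ |y| ^ 3 * 4 := by gcongr
      _ = _ := by ring
  · have h1 : ‖Complex.exp (y * Complex.I)‖ = 1 := Complex.norm_exp_ofReal_mul_I y
    have h2 : ‖(y : ℂ) * Complex.I‖ = |y| := by simp
    have h3 : ‖(y : ℂ) ^ 2 / 2‖ = |y| ^ 2 / 2 := by simp
    have h4 := norm_add_le (Complex.exp (y * Complex.I) - 1 - y * Complex.I) ((y : ℂ) ^ 2 / 2)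
    have h5 := norm_sub_le (Complex.exp (y * Complex.I) - 1) (y * Complex.I)
    have h6 := norm_sub_le (Complex.exp (y * Complex.I)) 1
    rw [norm_one] at h6
    have h7 : |y| ≤ |y| ^ 3 := le_self_pow₀ hy (by norm_num)
    have h8 : |y| ^ 2 ≤ |y| ^ 3 := pow_le_pow_right₀ hy (by norm_num)
    linarith

theorem norm_mul_exp_ofReal_mul_I (hp : ∀ k, 0 ≤ p k) (k : ℕ) (y : ℝ) :
    ‖(p k : ℂ) * Complex.exp (y * Complex.I)‖ = p k := by
  rw [norm_mul, Complex.norm_exp_ofReal_mul_I, mul_one, Complex.norm_real,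
    Real.norm_of_nonneg (hp k)]

theorem hasSum_centredCharFun (hp : ∀ k, 0 ≤ p k) (h1 : HasSum p 1) (θ : ℝ) :
    HasSum (fun k : ℕ => (p k : ℂ) * Complex.exp ((((k : ℝ) - 1) * θ : ℝ) * Complex.I))
      (centredCharFun p θ) := by
  refine Summable.hasSum (Summable.of_norm ?_)
  simpa only [norm_mul_exp_ofReal_mul_I hp] using h1.summable

theorem continuous_centredCharFun (hp : ∀ k, 0 ≤ p k) (h1 : HasSum p 1) :
    Continuous (centredCharFun p) :=
  continuous_tsum (fun k => by fun_prop) h1.summable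
    fun k θ => (norm_mul_exp_ofReal_mul_I hp k _).le

theorem summable_sub_one_pow_mul (h0 : Summable p) (hm : Summable fun k : ℕ => (k : ℝ) * p k)
    (h2 : Summable fun k : ℕ => (k : ℝ) ^ 2 * p k) :
    Summable fun k : ℕ => ((k : ℝ) - 1) ^ 2 * p k :=
  ((h2.sub (hm.mul_left 2)).add h0).congr fun k => by ring

/-- Second order Taylor expansion of the characteristic function of a centred variable. -/
theorem exists_norm_centredCharFun_sub_le (hp : ∀ k, 0 ≤ p k) (h1 : HasSum p 1)
    (hm : HasSum (fun k : ℕ => (k : ℝ) * p k) 1)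
    (h2 : Summable fun k : ℕ => (k : ℝ) ^ 2 * p k)
    (h3 : Summable fun k : ℕ => (k : ℝ) ^ 3 * p k) {v : ℝ}
    (hv : v = ∑' k : ℕ, ((k : ℝ) - 1) ^ 2 * p k) :
    ∃ C : ℝ, 0 ≤ C ∧ ∀ θ : ℝ, ‖centredCharFun p θ - 1 + v * (θ : ℂ) ^ 2 / 2‖ ≤ C * |θ| ^ 3 := by
  have hs3 : Summable fun k : ℕ => 4 * |(k : ℝ) - 1| ^ 3 * p k := by
    refine Summable.of_nonneg_of_le (fun k => mul_nonneg (by positivity) (hp k))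
      (fun k => ?_) ((h3.add h1.summable).mul_left 4)
    have hk : |(k : ℝ) - 1| ^ 3 ≤ (k : ℝ) ^ 3 + 1 := by
      rcases le_total (1 : ℝ) k with h | h
      · rw [abs_of_nonneg (by linarith)]
        have := pow_le_pow_left₀ (by linarith) (show (k : ℝ) - 1 ≤ k by linarith) 3
        linarith
      · rw [abs_of_nonpos (by linarith)]
        have : (0 : ℝ) ≤ k := k.cast_nonneg
        have := pow_le_pow_left₀ (by linarith) (show -((k : ℝ) - 1) ≤ 1 by linarith) 3
        have : (0 : ℝ) ≤ (k : ℝ) ^ 3 := by positivity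
        linarith
    have := mul_le_mul_of_nonneg_right hk (hp k)
    linarith
  refine ⟨∑' k : ℕ, 4 * |(k : ℝ) - 1| ^ 3 * p k,
    tsum_nonneg fun k => mul_nonneg (by positivity) (hp k), fun θ => ?_⟩
  have e1 : HasSum (fun k => (p k : ℂ)) 1 := by
    have := Complex.hasSum_ofReal.2 h1
    simpa using this
  have e2 : HasSum (fun k : ℕ => ((((k : ℝ) - 1) * p k : ℝ) : ℂ)) 0 := by
    have := Complex.hasSum_ofReal.2 ((hm.sub h1).congr_fun (fun k => by ring) :
      HasSum (fun k : ℕ => ((k : ℝ) - 1) * p k) (1 - 1))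
    simpa using this
  have e3 : HasSum (fun k : ℕ => ((((k : ℝ) - 1) ^ 2 * p k : ℝ) : ℂ)) v := by
    rw [hv]
    exact Complex.hasSum_ofReal.2 (summable_sub_one_pow_mul h1.summable hm.summable h2).hasSum
  have hs := (((hasSum_centredCharFun hp h1 θ).sub e1).sub (e2.mul_right (θ * Complex.I))).add
    (e3.mul_right ((θ : ℂ) ^ 2 / 2))
  have hval : centredCharFun p θ - 1 - 0 * (θ * Complex.I) + v * ((θ : ℂ) ^ 2 / 2) =
      centredCharFun p θ - 1 + v * (θ : ℂ) ^ 2 / 2 := by ring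
  rw [hval] at hs
  rw [← hs.tsum_eq]
  refine tsum_of_norm_bounded (hs3.hasSum.mul_right (|θ| ^ 3)) fun k => ?_
  have hb := norm_exp_mul_I_sub_taylor_le (((k : ℝ) - 1) * θ)
  have he : (p k : ℂ) * Complex.exp ((((k : ℝ) - 1) * θ : ℝ) * Complex.I) - p k -
      ((((k : ℝ) - 1) * p k : ℝ) : ℂ) * (θ * Complex.I) +
      ((((k : ℝ) - 1) ^ 2 * p k : ℝ) : ℂ) * ((θ : ℂ) ^ 2 / 2) =
      p k * (Complex.exp ((((k : ℝ) - 1) * θ : ℝ) * Complex.I) - 1 -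
        ((((k : ℝ) - 1) * θ : ℝ) : ℂ) * Complex.I + ((((k : ℝ) - 1) * θ : ℝ) : ℂ) ^ 2 / 2) := by
    push_cast
    ring
  rw [he, norm_mul, Complex.norm_real, Real.norm_of_nonneg (hp k)]
  calc _ ≤ p k * (4 * |((k : ℝ) - 1) * θ| ^ 3) := by gcongr; exact hp k
    _ = _ := by rw [abs_mul]; ring

/-- Equality in the triangle inequality forces the terms `k` and `0` to have the same argument. -/
theorem exp_mul_I_pow_eq_one_of_one_le_norm (hp : ∀ k, 0 ≤ p k) (h1 : HasSum p 1) (hp0 : 0 < p 0)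
    {θ : ℝ} (hθ : 1 ≤ ‖centredCharFun p θ‖) {k : ℕ} (hk1 : 1 ≤ k) (hk : p k ≠ 0) :
    Complex.exp (θ * Complex.I) ^ k = 1 := by
  have hk0 : 0 < p k := (hp k).lt_of_ne' hk
  set f : ℕ → ℂ := fun k => (p k : ℂ) * Complex.exp ((((k : ℝ) - 1) * θ : ℝ) * Complex.I) with hf
  have hnf : ∀ k, ‖f k‖ = p k := fun k => norm_mul_exp_ofReal_mul_I hp k _
  have hfs : Summable f := (hasSum_centredCharFun hp h1 θ).summable
  set S : Finset ℕ := {0, k} with hS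
  have hk0' : (0 : ℕ) ≠ k := by omega
  have s1 := hfs.sum_add_tsum_compl (s := S)
  have s2 := h1.summable.sum_add_tsum_compl (s := S)
  rw [h1.tsum_eq, hS, Finset.sum_pair hk0'] at s2
  rw [hS, Finset.sum_pair hk0'] at s1
  have hrest : ‖∑' x : ↥((S : Set ℕ)ᶜ), f x‖ ≤ ∑' x : ↥((S : Set ℕ)ᶜ), p x :=
    tsum_of_norm_bounded (h1.summable.subtype _).hasSum fun x => (hnf x).le
  have htot : ‖centredCharFun p θ‖ ≤ ‖f 0 + f k‖ + ∑' x : ↥((S : Set ℕ)ᶜ), p x := by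
    change ‖∑' k, f k‖ ≤ _
    rw [← s1]
    exact (norm_add_le _ _).trans (by gcongr)
  have heq : ‖f 0 + f k‖ = ‖f 0‖ + ‖f k‖ := by
    refine le_antisymm (norm_add_le _ _) ?_
    rw [hnf, hnf]
    linarith
  have hray := sameRay_iff_norm_smul_eq.1 (sameRay_iff_norm_add.2 heq)
  rw [hnf, hnf, Complex.real_smul, Complex.real_smul, hf] at hray
  simp only at hray
  have hp0' : (p 0 : ℂ) ≠ 0 := by exact_mod_cast hp0.ne'
  have hpk' : (p k : ℂ) ≠ 0 := by exact_mod_cast hk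
  have hexp : Complex.exp ((((k : ℝ) - 1) * θ : ℝ) * Complex.I) =
      Complex.exp (((((0 : ℕ) : ℝ) - 1) * θ : ℝ) * Complex.I) := by
    apply mul_left_cancel₀ (mul_ne_zero hp0' hpk')
    linear_combination hray
  rw [← Complex.exp_nat_mul]
  have h2 : (k : ℂ) * (θ * Complex.I) = (((k : ℝ) - 1) * θ : ℝ) * Complex.I -
      ((((0 : ℕ) : ℝ) - 1) * θ : ℝ) * Complex.I := by
    push_cast; ring
  rw [h2, Complex.exp_sub, hexp, div_self (Complex.exp_ne_zero _)]

/-- On the fundamental interval `[-π / Q, π / Q]` of the lattice, the characteristic function has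
modulus one at the origin only. -/
theorem norm_centredCharFun_lt_one (hp : ∀ k, 0 ≤ p k) (h1 : HasSum p 1) (hp0 : 0 < p 0)
    {Q : ℕ} (hQ : Q = Nat.setGcd {n | 1 ≤ n ∧ p n ≠ 0}) (hQ0 : 0 < Q) {θ : ℝ}
    (hθ : |θ| ≤ Real.pi / Q) (hθ0 : θ ≠ 0) : ‖centredCharFun p θ‖ < 1 := by
  by_contra hcon
  have hdvd : orderOf (Complex.exp (θ * Complex.I)) ∣ Q := by
    rw [hQ]
    refine Nat.dvd_setGcd_iff.2 fun k hk => orderOf_dvd_of_pow_eq_one ?_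
    exact exp_mul_I_pow_eq_one_of_one_le_norm hp h1 hp0 (not_lt.1 hcon) hk.1 hk.2
  have h := orderOf_dvd_iff_pow_eq_one.1 hdvd
  rw [← Complex.exp_nat_mul, Complex.exp_eq_one_iff] at h
  obtain ⟨n, hn⟩ := h
  have hn' : (Q : ℝ) * θ = n * (2 * Real.pi) := by
    have h2 : ((Q : ℂ) * θ) * Complex.I = (n * (2 * Real.pi)) * Complex.I := by
      linear_combination hn
    exact_mod_cast mul_right_cancel₀ Complex.I_ne_zero h2
  have hQ0' : (0 : ℝ) < Q := by exact_mod_cast hQ0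
  have habs : |(n : ℝ)| * (2 * Real.pi) ≤ Real.pi := by
    rw [← abs_of_pos Real.two_pi_pos, ← abs_mul, ← hn', abs_mul, abs_of_pos hQ0', mul_comm]
    exact (le_div_iff₀ hQ0').1 hθ
  have hn0 : n ≠ 0 := by
    rintro rfl
    simp only [Int.cast_zero, zero_mul, mul_eq_zero] at hn'
    exact hn'.elim hQ0'.ne' hθ0
  have h1n : (1 : ℝ) ≤ |(n : ℝ)| := by exact_mod_cast Int.one_le_abs hn0
  nlinarith [Real.pi_pos]

/-- Gaussian domination of the characteristic function on the fundamental interval. -/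
theorem exists_norm_centredCharFun_le_exp (hp : ∀ k, 0 ≤ p k) (h1 : HasSum p 1) (hp0 : 0 < p 0)
    {Q : ℕ} (hQ : Q = Nat.setGcd {n | 1 ≤ n ∧ p n ≠ 0}) (hQ0 : 0 < Q) {v C : ℝ} (hv : 0 < v)
    (hC : 0 ≤ C)
    (htaylor : ∀ θ : ℝ, ‖centredCharFun p θ - 1 + v * (θ : ℂ) ^ 2 / 2‖ ≤ C * |θ| ^ 3) :
    ∃ c : ℝ, 0 < c ∧ ∀ θ : ℝ, |θ| ≤ Real.pi / Q →
      ‖centredCharFun p θ‖ ≤ Real.exp (-c * θ ^ 2) := by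
  -- on `|θ| ≤ δ` the cubic remainder is at most half of the quadratic term
  obtain ⟨δ, hδ0, hδv, hδC⟩ : ∃ δ : ℝ, 0 < δ ∧ v * δ ^ 2 ≤ 2 ∧ C * δ ≤ v / 4 := by
    have t1 : Tendsto (fun δ : ℝ => v * δ ^ 2) (𝓝[>] 0) (𝓝 (v * 0 ^ 2)) :=
      Tendsto.mono_left (by apply Continuous.tendsto; fun_prop) nhdsWithin_le_nhds
    have t2 : Tendsto (fun δ : ℝ => C * δ) (𝓝[>] 0) (𝓝 (C * 0)) :=
      Tendsto.mono_left (by apply Continuous.tendsto; fun_prop) nhdsWithin_le_nhds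
    have t0 : ∀ᶠ δ : ℝ in 𝓝[>] 0, 0 < δ := eventually_mem_nhdsWithin
    obtain ⟨δ, h⟩ := (t0.and ((t1.eventually_le_const (u := 2) (by norm_num)).and
      (t2.eventually_le_const (u := v / 4) (by simpa using hv)))).exists
    exact ⟨δ, h.1, h.2.1, h.2.2⟩
  have hnear : ∀ θ : ℝ, |θ| ≤ δ → ‖centredCharFun p θ‖ ≤ Real.exp (-(v / 4) * θ ^ 2) := by
    intro θ hθ
    have hsq : θ ^ 2 ≤ δ ^ 2 := sq_le_sq.2 (by rwa [abs_of_pos hδ0])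
    have hn1 : ‖(1 : ℂ) - v * (θ : ℂ) ^ 2 / 2‖ = 1 - v * θ ^ 2 / 2 := by
      rw [show (1 : ℂ) - v * (θ : ℂ) ^ 2 / 2 = ((1 - v * θ ^ 2 / 2 : ℝ) : ℂ) by push_cast; ring,
        Complex.norm_real, Real.norm_of_nonneg]
      nlinarith
    have hn2 : ‖centredCharFun p θ‖ ≤ (1 - v * θ ^ 2 / 2) + C * |θ| ^ 3 := by
      rw [← hn1]
      calc ‖centredCharFun p θ‖ = ‖((1 : ℂ) - v * (θ : ℂ) ^ 2 / 2) +
          (centredCharFun p θ - 1 + v * (θ : ℂ) ^ 2 / 2)‖ := by congr 1; ring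
        _ ≤ _ := (norm_add_le _ _).trans (by gcongr; exact htaylor θ)
    have hn3 : C * |θ| ^ 3 ≤ v / 4 * θ ^ 2 := by
      calc C * |θ| ^ 3 = C * |θ| * θ ^ 2 := by rw [← sq_abs θ]; ring
        _ ≤ v / 4 * θ ^ 2 := by
          gcongr
          exact (mul_le_mul_of_nonneg_left hθ hC).trans hδC
    have := Real.add_one_le_exp (-(v / 4) * θ ^ 2)
    linarith
  -- away from the origin, compactness bounds the modulus by some `q < 1`
  obtain ⟨q, hq1, hfar⟩ : ∃ q : ℝ, q < 1 ∧ ∀ θ : ℝ, |θ| ≤ Real.pi / Q → δ ≤ |θ| →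
      ‖centredCharFun p θ‖ ≤ q := by
    set K : Set ℝ := {θ | |θ| ≤ Real.pi / Q ∧ δ ≤ |θ|} with hK
    have hKc : IsCompact K := by
      refine (isCompact_Icc (a := -(Real.pi / Q)) (b := Real.pi / Q)).of_isClosed_subset ?_
        fun θ hθ => abs_le.1 hθ.1
      exact (isClosed_le continuous_abs continuous_const).inter
        (isClosed_le continuous_const continuous_abs)
    rcases K.eq_empty_or_nonempty with hKe | hKn
    · refine ⟨0, one_pos, fun θ h2 h3 => ?_⟩
      have : θ ∈ K := ⟨h2, h3⟩
      simp [hKe] at this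
    · obtain ⟨θ₀, hθ₀, hmax⟩ := hKc.exists_isMaxOn hKn
        (continuous_centredCharFun hp h1).norm.continuousOn
      refine ⟨‖centredCharFun p θ₀‖, norm_centredCharFun_lt_one hp h1 hp0 hQ hQ0 hθ₀.1 ?_,
        fun θ h2 h3 => hmax (show θ ∈ K from ⟨h2, h3⟩)⟩
      rintro rfl
      have := hθ₀.2
      simp at this
      linarith
  refine ⟨min (v / 4) ((1 - q) / Real.pi ^ 2), lt_min (by linarith)
    (div_pos (by linarith) (by positivity)), fun θ hθ => ?_⟩
  rcases le_total |θ| δ with h | h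
  · refine (hnear θ h).trans (Real.exp_le_exp.2 ?_)
    have := mul_le_mul_of_nonneg_right (min_le_left (v / 4) ((1 - q) / Real.pi ^ 2)) (sq_nonneg θ)
    linarith
  · have hQ1 : (1 : ℝ) ≤ Q := by exact_mod_cast hQ0
    have hθπ : θ ^ 2 ≤ Real.pi ^ 2 := by
      refine sq_le_sq.2 (hθ.trans ?_)
      rw [abs_of_pos Real.pi_pos]
      exact div_le_self Real.pi_pos.le hQ1
    have h2 := mul_le_mul_of_nonneg_right (min_le_right (v / 4) ((1 - q) / Real.pi ^ 2))
      (sq_nonneg θ)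
    have h3 : (1 - q) / Real.pi ^ 2 * θ ^ 2 ≤ 1 - q := by
      calc _ ≤ (1 - q) / Real.pi ^ 2 * Real.pi ^ 2 := by
            gcongr
        _ = 1 - q := div_mul_cancel₀ _ (by positivity)
    have h4 := Real.add_one_le_exp (-min (v / 4) ((1 - q) / Real.pi ^ 2) * θ ^ 2)
    linarith [hfar θ hθ h]

theorem tendsto_centredCharFun_pow {v C : ℝ}
    (htaylor : ∀ θ : ℝ, ‖centredCharFun p θ - 1 + v * (θ : ℂ) ^ 2 / 2‖ ≤ C * |θ| ^ 3) (x : ℝ) :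
    Tendsto (fun n : ℕ => centredCharFun p (x / √n) ^ n) atTop
      (𝓝 (Complex.exp (-(v * x ^ 2 / 2)))) := by
  have key : Tendsto (fun n : ℕ => (n : ℂ) * (centredCharFun p (x / √n) - 1)) atTop
      (𝓝 (-(v * x ^ 2 / 2))) := by
    rw [tendsto_iff_norm_sub_tendsto_zero]
    have hlim : Tendsto (fun n : ℕ => C * |x| ^ 3 / √(n : ℝ)) atTop (𝓝 0) :=
      Tendsto.div_atTop tendsto_const_nhds
        (Real.tendsto_sqrt_atTop.comp tendsto_natCast_atTop_atTop)
    refine squeeze_zero' (Eventually.of_forall fun n => norm_nonneg _) ?_ hlim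
    filter_upwards [eventually_gt_atTop 0] with n hn
    have hn0 : (0 : ℝ) < n := by exact_mod_cast hn
    have hs : (0 : ℝ) < √n := Real.sqrt_pos.2 hn0
    have hsq : (√n : ℝ) ^ 2 = n := Real.sq_sqrt hn0.le
    have hsqC : ((√(n : ℝ) : ℝ) : ℂ) ^ 2 = n := by exact_mod_cast hsq
    have hsC : ((√(n : ℝ) : ℝ) : ℂ) ≠ 0 := by exact_mod_cast hs.ne'
    have he : (n : ℂ) * (centredCharFun p (x / √n) - 1) - -(v * x ^ 2 / 2) =
        n * (centredCharFun p (x / √n) - 1 + v * ((x / √n : ℝ) : ℂ) ^ 2 / 2) := by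
      push_cast
      rw [div_pow, hsqC]
      have : (n : ℂ) ≠ 0 := by exact_mod_cast hn.ne'
      field_simp
      ring
    rw [he, norm_mul, Complex.norm_natCast]
    calc _ ≤ n * (C * |x / √n| ^ 3) := by gcongr; exact htaylor _
      _ = C * |x| ^ 3 / √n := by
        rw [abs_div, abs_of_pos hs, div_pow]
        nth_rewrite 1 [← hsq]
        field_simp
  have := Complex.tendsto_one_add_pow_exp_of_tendsto key
  simpa using this

/-- The local limit theorem in Fourier form: after the substitution `θ = x / √n` the integrand
tends to a Gaussian density. -/
theorem tendsto_sqrt_mul_integral_centredCharFun (hp : ∀ k, 0 ≤ p k) (h1 : HasSum p 1)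
    (hp0 : 0 < p 0) (hm : HasSum (fun k : ℕ => (k : ℝ) * p k) 1)
    (h2 : Summable fun k : ℕ => (k : ℝ) ^ 2 * p k)
    (h3 : Summable fun k : ℕ => (k : ℝ) ^ 3 * p k) {v : ℝ}
    (hv : v = ∑' k : ℕ, ((k : ℝ) - 1) ^ 2 * p k) (hv0 : 0 < v)
    {Q : ℕ} (hQ : Q = Nat.setGcd {n | 1 ≤ n ∧ p n ≠ 0}) (hQ0 : 0 < Q) :
    Tendsto (fun n : ℕ => (√n : ℂ) * ∫ θ in (-(Real.pi / Q))..(Real.pi / Q),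
      centredCharFun p θ ^ n * Complex.exp (θ * Complex.I)) atTop
      (𝓝 (√(2 * Real.pi / v) : ℝ)) := by
  obtain ⟨C, hC0, htaylor⟩ := exists_norm_centredCharFun_sub_le hp h1 hm h2 h3 hv
  obtain ⟨c, hc0, hbound⟩ := exists_norm_centredCharFun_le_exp hp h1 hp0 hQ hQ0 hv0 hC0 htaylor
  have hcont := continuous_centredCharFun hp h1
  set T : ℝ := Real.pi / Q with hT
  have hQ0' : (0 : ℝ) < Q := by exact_mod_cast hQ0
  have hT0 : 0 < T := div_pos Real.pi_pos hQ0'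
  set F : ℕ → ℝ → ℂ := fun n => (Set.Ioc (-(T * √n)) (T * √n)).indicator fun x =>
    centredCharFun p (x / √n) ^ n * Complex.exp ((x / √n : ℝ) * Complex.I) with hF
  have hint : Tendsto (fun n => ∫ x, F n x) atTop
      (𝓝 (∫ x : ℝ, Complex.exp (-(v * x ^ 2 / 2)))) := by
    refine MeasureTheory.tendsto_integral_of_dominated_convergence
      (fun x => Real.exp (-c * x ^ 2)) (fun n => ?_) (integrable_exp_neg_mul_sq hc0)
      (fun n => Eventually.of_forall fun x => ?_) (Eventually.of_forall fun x => ?_)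
    · refine MeasureTheory.AEStronglyMeasurable.indicator (Continuous.aestronglyMeasurable ?_)
        measurableSet_Ioc
      fun_prop
    · by_cases hx : x ∈ Set.Ioc (-(T * √n)) (T * √n)
      · rw [hF]
        simp only [Set.indicator_of_mem hx]
        have hn : n ≠ 0 := by
          rintro rfl
          simp at hx
        have hn0 : (0 : ℝ) < n := by exact_mod_cast Nat.pos_of_ne_zero hn
        have hs : (0 : ℝ) < √n := Real.sqrt_pos.2 hn0
        have hxT : |x / √n| ≤ T := by
          rw [abs_div, abs_of_pos hs, div_le_iff₀ hs]
          exact abs_le.2 ⟨hx.1.le, hx.2⟩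
        rw [norm_mul, norm_pow, Complex.norm_exp_ofReal_mul_I, mul_one]
        calc _ ≤ Real.exp (-c * (x / √n) ^ 2) ^ n := by gcongr; exact hbound _ hxT
          _ = Real.exp (-c * x ^ 2) := by
            rw [← Real.exp_nat_mul, div_pow, Real.sq_sqrt hn0.le]
            congr 1
            field_simp
      · rw [hF]
        simp only [Set.indicator_of_notMem hx, norm_zero]
        positivity
    · have hsqrt : Tendsto (fun n : ℕ => √(n : ℝ)) atTop atTop :=
        Real.tendsto_sqrt_atTop.comp tendsto_natCast_atTop_atTop
      have hlim : Tendsto (fun n : ℕ => centredCharFun p (x / √n) ^ n *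
          Complex.exp ((x / √n : ℝ) * Complex.I)) atTop
          (𝓝 (Complex.exp (-(v * x ^ 2 / 2)) * 1)) := by
        refine (tendsto_centredCharFun_pow htaylor x).mul ?_
        have h0 : Tendsto (fun n : ℕ => x / √(n : ℝ)) atTop (𝓝 0) :=
          tendsto_const_nhds.div_atTop hsqrt
        have hc : Continuous fun y : ℝ => Complex.exp (y * Complex.I) := by fun_prop
        simpa [Function.comp_def] using (hc.tendsto 0).comp h0
      rw [mul_one] at hlim
      refine hlim.congr' ?_
      filter_upwards [(hsqrt.const_mul_atTop hT0).eventually_gt_atTop |x|] with n hn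
      have hx : x ∈ Set.Ioc (-(T * √n)) (T * √n) := ⟨(abs_lt.1 hn).1, (abs_lt.1 hn).2.le⟩
      rw [hF]
      simp only [Set.indicator_of_mem hx]
  have hgauss : ∫ x : ℝ, Complex.exp (-(v * x ^ 2 / 2)) = ((√(2 * Real.pi / v) : ℝ) : ℂ) := by
    have h := integral_gaussian (v / 2)
    rw [show Real.pi / (v / 2) = 2 * Real.pi / v by field_simp] at h
    rw [← h, ← integral_complex_ofReal]
    congr 1
    funext x
    push_cast
    congr 1
    ring
  rw [hgauss] at hint
  refine hint.congr' ?_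
  filter_upwards [eventually_gt_atTop 0] with n hn
  have hn0 : (0 : ℝ) < n := by exact_mod_cast hn
  have hs : (0 : ℝ) < √n := Real.sqrt_pos.2 hn0
  have hle : -(T * √n) ≤ T * √n := by
    have := mul_pos hT0 hs
    linarith
  rw [hF]
  simp only
  rw [MeasureTheory.integral_indicator measurableSet_Ioc, ← intervalIntegral.integral_of_le hle]
  have := intervalIntegral.integral_comp_div (a := -(T * √n)) (b := T * √n)
    (fun θ : ℝ => centredCharFun p θ ^ n * Complex.exp (θ * Complex.I)) hs.ne'
  rw [this, neg_div, mul_div_cancel_right₀ _ hs.ne', Complex.real_smul]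

/-- Since `X` takes its values in `Q ℕ`, for `n ≡ 1` modulo `Q` the Fourier integral over a period
is `Q` times the integral over the fundamental interval. -/
theorem integral_centredCharFun_eq (hp : ∀ k, 0 ≤ p k) (h1 : HasSum p 1)
    {Q : ℕ} (hQ : Q = Nat.setGcd {n | 1 ≤ n ∧ p n ≠ 0}) (hQ0 : 0 < Q) {m : ℕ} (hm : Q ∣ m) :
    ∫ θ in (0)..(2 * Real.pi), centredCharFun p θ ^ (m + 1) * Complex.exp (θ * Complex.I) =
      Q * ∫ θ in (-(Real.pi / Q))..(Real.pi / Q),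
        centredCharFun p θ ^ (m + 1) * Complex.exp (θ * Complex.I) := by
  set G : ℝ → ℂ := fun θ => centredCharFun p θ ^ (m + 1) * Complex.exp (θ * Complex.I) with hG
  have hcont := continuous_centredCharFun hp h1
  have hGc : Continuous G := by fun_prop
  have hQ0' : (0 : ℝ) < Q := by exact_mod_cast hQ0
  have hQC : (Q : ℂ) ≠ 0 := by exact_mod_cast hQ0.ne'
  set P : ℝ := 2 * Real.pi / Q with hP
  have hexp1 : ∀ {k : ℕ}, Q ∣ k → Complex.exp ((k * P : ℝ) * Complex.I) = 1 := by
    rintro _ ⟨j, rfl⟩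
    rw [Complex.exp_eq_one_iff]
    refine ⟨j, ?_⟩
    rw [hP]
    push_cast
    field_simp
  have hshift : ∀ θ, centredCharFun p (θ + P) =
      centredCharFun p θ * Complex.exp (-(P * Complex.I)) := by
    intro θ
    rw [centredCharFun, centredCharFun, ← tsum_mul_right]
    refine tsum_congr fun k => ?_
    by_cases hk : p k = 0
    · simp [hk]
    have hdvd : Q ∣ k := by
      rcases Nat.eq_zero_or_pos k with rfl | hk1
      · exact dvd_zero _
      · rw [hQ]; exact Nat.setGcd_dvd_of_mem ⟨hk1, hk⟩
    rw [mul_assoc, ← Complex.exp_add]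
    have h := hexp1 hdvd
    have he : (((((k : ℝ) - 1) * (θ + P) : ℝ)) : ℂ) * Complex.I =
        ((((k : ℝ) - 1) * θ : ℝ) * Complex.I + -(P * Complex.I)) + (k * P : ℝ) * Complex.I := by
      push_cast; ring
    rw [he, Complex.exp_add _ ((k * P : ℝ) * Complex.I), h, mul_one]
  have hper : Function.Periodic G P := by
    intro θ
    simp only [hG]
    rw [hshift, mul_pow, ← Complex.exp_nat_mul, mul_assoc, ← Complex.exp_add]
    have he : ((m + 1 : ℕ) : ℂ) * -(P * Complex.I) + ((θ + P : ℝ) : ℂ) * Complex.I =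
        θ * Complex.I - (m * P : ℝ) * Complex.I := by
      push_cast; ring
    rw [he, Complex.exp_sub, hexp1 hm, div_one]
  have hz := hper.intervalIntegral_add_zsmul_eq Q 0 fun a b => hGc.intervalIntegrable a b
  have hQP : (0 : ℝ) + (Q : ℤ) • P = 2 * Real.pi := by
    rw [hP]; simp; field_simp
  rw [hQP, hper.intervalIntegral_add_eq 0 (-(Real.pi / Q))] at hz
  have hend : -(Real.pi / Q) + P = Real.pi / Q := by rw [hP]; ring
  rw [hend] at hz
  rw [hz]
  simp

end Khinchin

namespace Khinchin

variable {b : ℕ → ℝ} {τ : ℝ}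

/-! ### Asymptotics of the coefficients -/

theorem psiC_circleMap (hb : ClassK b) (hτ0 : 0 < τ) (hτ : ENNReal.ofReal τ < radius b) (θ : ℝ) :
    psiC b (circleMap 0 τ θ) =
      psi b τ * Complex.exp (θ * Complex.I) * centredCharFun (mass b τ) θ := by
  have hψ : (psi b τ : ℂ) ≠ 0 := by exact_mod_cast (psi_pos hb hτ0.le hτ).ne'
  rw [centredCharFun, ← tsum_mul_left, psiC]
  refine tsum_congr fun k => ?_
  have he : ((((k : ℝ) - 1) * θ : ℝ) : ℂ) * Complex.I =
      k * (θ * Complex.I) - θ * Complex.I := by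
    push_cast; ring
  rw [he, Complex.exp_sub, Complex.exp_nat_mul, circleMap_zero, mul_pow, mass]
  have := Complex.exp_ne_zero (θ * Complex.I)
  push_cast
  field_simp

/-- Cauchy's formula on the circle of radius `τ`, written with the characteristic function. -/
theorem powCoeff_mul_pow_eq_integral (hb : ClassK b) (hτ0 : 0 < τ)
    (hτ : ENNReal.ofReal τ < radius b) (m : ℕ) :
    (powCoeff b (m + 1) m : ℂ) * τ ^ m = psi b τ ^ (m + 1) * (2 * Real.pi)⁻¹ *
      ∫ θ in (0)..(2 * Real.pi),
        centredCharFun (mass b τ) θ ^ (m + 1) * Complex.exp (θ * Complex.I) := by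
  have h := (hasFPowerSeriesAt_psiC_pow hb (m + 1)).coeff_eq_circleIntegral hτ0
    ((differentiableOn_psiC hb hτ).pow (m + 1)) m
  rw [FormalMultilinearSeries.coeff_ofScalars] at h
  have hτC : (τ : ℂ) ≠ 0 := by exact_mod_cast hτ0.ne'
  have hpt : ∀ θ : ℝ, deriv (circleMap 0 τ) θ •
      ((circleMap 0 τ θ ^ (m + 1))⁻¹ * psiC b (circleMap 0 τ θ) ^ (m + 1)) =
      (Complex.I * (τ ^ m : ℂ)⁻¹ * psi b τ ^ (m + 1)) *
        (centredCharFun (mass b τ) θ ^ (m + 1) * Complex.exp (θ * Complex.I)) := fun θ => by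
    rw [psiC_circleMap hb hτ0 hτ, deriv_circleMap, circleMap_zero, smul_eq_mul]
    have := Complex.exp_ne_zero (θ * Complex.I)
    simp only [mul_pow]
    field_simp
    ring
  rw [circleIntegral] at h
  simp only [hpt] at h
  rw [intervalIntegral.integral_const_mul] at h
  rw [h]
  have := Real.pi_pos.ne'
  have hπ : (Real.pi : ℂ) ≠ 0 := by exact_mod_cast this
  have := Complex.I_ne_zero
  push_cast
  field_simp

/-- The coefficients of the solution of Lagrange's equation: `A n = [z ^ (n - 1)] ψ(z) ^ n / n`,
where `A 0 = 0` because of the division by zero. -/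
noncomputable def lagrangeCoeff (b : ℕ → ℝ) (n : ℕ) : ℝ := powCoeff b n (n - 1) / n

theorem psiC_zero (b : ℕ → ℝ) : psiC b 0 = b 0 := by
  have h : HasSum (fun n => (b n : ℂ) * 0 ^ n) ((b 0 : ℂ) * 0 ^ 0) :=
    hasSum_single 0 fun n hn => by simp [hn]
  rw [psiC, h.tsum_eq]
  simp

theorem psiC_zero_ne_zero (hb : ClassK b) : psiC b 0 ≠ 0 := by
  rw [psiC_zero]
  exact_mod_cast hb.constantCoeff_pos.ne'

theorem analyticAt_psiC (hb : ClassK b) : AnalyticAt ℂ (psiC b) 0 := by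
  simpa using (hasFPowerSeriesAt_psiC_pow hb 1).analyticAt

theorem exists_isLagrangeSolution (hb : ClassK b) : ∃ g, IsLagrangeSolution b g := by
  obtain ⟨g, hg, h⟩ := exists_analyticAt_lagrange (analyticAt_psiC hb) (psiC_zero_ne_zero hb)
  exact ⟨g, hg, h⟩

theorem IsLagrangeSolution.hasFPowerSeriesAt (hb : ClassK b) {g : ℂ → ℂ}
    (hg : IsLagrangeSolution b g) : HasFPowerSeriesAt g
      (FormalMultilinearSeries.ofScalars ℂ fun n => (lagrangeCoeff b n : ℂ)) 0 := by
  have h := hg.analyticAt.hasFPowerSeriesAt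
  suffices hcoef : ∀ n, (lagrangeCoeff b n : ℂ) = iteratedDeriv n g 0 / (n.factorial : ℂ) by
    simpa only [hcoef] using h
  intro n
  cases n with
  | zero =>
    have : g 0 = 0 := by simpa using hg.equation.self_of_nhds
    simp [lagrangeCoeff, this]
  | succ m =>
    have hL := iteratedDeriv_div_factorial_eq_coeff_of_lagrange (analyticAt_psiC hb)
      (psiC_zero_ne_zero hb) hg.analyticAt hg.equation (hasFPowerSeriesAt_psiC_pow hb (m + 1))
    rw [FormalMultilinearSeries.coeff_ofScalars] at hL
    rw [lagrangeCoeff, Nat.add_sub_cancel, Complex.ofReal_div, ← hL, Nat.factorial_succ]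
    push_cast
    rw [div_div, mul_comm]

theorem lagrangeCoeff_eq_zero {n : ℕ} (hn : ¬ n ≡ 1 [MOD gcdIndex b]) :
    lagrangeCoeff b n = 0 := by
  rcases Nat.eq_zero_or_pos n with rfl | hpos
  · simp [lagrangeCoeff]
  · have : ¬ gcdIndex b ∣ n - 1 := fun h => hn ((Nat.modEq_iff_dvd' hpos).2 h).symm
    rw [lagrangeCoeff, powCoeff_eq_zero_of_not_dvd n this, zero_div]

theorem variance_pos (hb : ClassK b) (hτ0 : 0 < τ) (hτ : ENNReal.ofReal τ < radius b)
    (hm : mean b τ = 1) : 0 < variance b τ := by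
  have hs := summable_sub_one_pow_mul (hasSum_mass hb hτ0.le hτ).summable
    (hasSum_mul_mass hb hτ0.le hτ).summable (summable_pow_mul_mass hb 2 hτ0.le hτ)
  rw [variance, hm]
  refine hs.tsum_pos (fun n => mul_nonneg (sq_nonneg _) (mass_nonneg hb hτ0.le hτ n)) 0 ?_
  have := hb.constantCoeff_pos
  have := psi_pos hb hτ0.le hτ
  simp only [mass, pow_zero, mul_one]
  norm_num
  positivity

theorem gcdIndex_eq_setGcd_mass (hb : ClassK b) (hτ0 : 0 < τ)
    (hτ : ENNReal.ofReal τ < radius b) :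
    gcdIndex b = Nat.setGcd {n | 1 ≤ n ∧ mass b τ n ≠ 0} := by
  rw [gcdIndex]
  congr 1
  ext n
  simp [mass, (psi_pos hb hτ0.le hτ).ne', hτ0.ne']

theorem lagrangeCoeff_isEquivalent (hb : ClassK b) (hτ0 : 0 < τ)
    (hτ : ENNReal.ofReal τ < radius b) (hm : mean b τ = 1) :
    lagrangeCoeff b ~[atTop ⊓ 𝓟 {n : ℕ | n ≡ 1 [MOD gcdIndex b]}]
      (fun n : ℕ => (gcdIndex b : ℝ) / √(2 * Real.pi) * (τ / sigma b τ) *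
        (1 / (n : ℝ) ^ (3 / 2 : ℝ)) * (psi b τ / τ) ^ n) := by
  have hp := mass_nonneg hb hτ0.le hτ
  have h1 := hasSum_mass hb hτ0.le hτ
  have hv0 := variance_pos hb hτ0 hτ hm
  have hψ := psi_pos hb hτ0.le hτ
  have hp0 : 0 < mass b τ 0 := by
    have := hb.constantCoeff_pos
    simp only [mass, pow_zero, mul_one]
    positivity
  have hQ := gcdIndex_eq_setGcd_mass hb hτ0 hτ
  have hQ0 := gcdIndex_pos hb
  have hv : variance b τ = ∑' k : ℕ, ((k : ℝ) - 1) ^ 2 * mass b τ k := by rw [variance, hm]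
  have hlim := tendsto_sqrt_mul_integral_centredCharFun hp h1 hp0
    (hm ▸ hasSum_mul_mass hb hτ0.le hτ) (summable_pow_mul_mass hb 2 hτ0.le hτ)
    (summable_pow_mul_mass hb 3 hτ0.le hτ) hv hv0 hQ hQ0
  set Q := gcdIndex b with hQdef
  set J : ℕ → ℂ := fun n => ∫ θ in (-(Real.pi / Q))..(Real.pi / Q),
    centredCharFun (mass b τ) θ ^ n * Complex.exp (θ * Complex.I) with hJ
  set σ := sigma b τ with hσ
  have hσ0 : 0 < σ := Real.sqrt_pos.2 hv0
  have h2π : 0 < √(2 * Real.pi) := Real.sqrt_pos.2 Real.two_pi_pos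
  rw [isEquivalent_iff_exists_eq_mul]
  -- the quotient of the two sides is the normalised Fourier integral of the local limit theorem
  refine ⟨fun n => ((√n : ℂ) * J n).re * (σ / √(2 * Real.pi)), ?_, ?_⟩
  · have h := ((Complex.continuous_re.tendsto _).comp hlim).mul_const (σ / √(2 * Real.pi))
    have he : ((√(2 * Real.pi / variance b τ) : ℝ) : ℂ).re * (σ / √(2 * Real.pi)) = 1 := by
      rw [Complex.ofReal_re, Real.sqrt_div Real.two_pi_pos.le]
      change √(2 * Real.pi) / σ * _ = 1
      field_simp
    rw [he] at h
    exact h.mono_left inf_le_left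
  · filter_upwards [mem_inf_of_left (eventually_gt_atTop 0), mem_inf_of_right (mem_principal_self _)]
      with n hn hmod
    obtain ⟨m, rfl⟩ : ∃ m, n = m + 1 := ⟨n - 1, (Nat.succ_pred_eq_of_pos hn).symm⟩
    have hdvd : Q ∣ m := (Nat.modEq_iff_dvd' (Nat.le_add_left 1 m)).1 (Nat.ModEq.symm hmod)
    have hc := powCoeff_mul_pow_eq_integral hb hτ0 hτ m
    rw [integral_centredCharFun_eq hp h1 hQ hQ0 hdvd] at hc
    change _ = _ * (Q * J (m + 1)) at hc
    have hcr : powCoeff b (m + 1) m * τ ^ m =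
        psi b τ ^ (m + 1) * (2 * Real.pi)⁻¹ * Q * (J (m + 1)).re := by
      have h := congrArg Complex.re hc
      rw [show (powCoeff b (m + 1) m : ℂ) * τ ^ m = ((powCoeff b (m + 1) m * τ ^ m : ℝ) : ℂ) by
          push_cast; rfl, Complex.ofReal_re,
        show (psi b τ : ℂ) ^ (m + 1) * (2 * Real.pi)⁻¹ * (Q * J (m + 1)) =
          ((psi b τ ^ (m + 1) * (2 * Real.pi)⁻¹ * Q : ℝ) : ℂ) * J (m + 1) by push_cast; ring,
        Complex.re_ofReal_mul] at h
      exact h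
    have hN : (0 : ℝ) < ((m + 1 : ℕ) : ℝ) := by exact_mod_cast hn
    have hs : 0 < √((m + 1 : ℕ) : ℝ) := Real.sqrt_pos.2 hN
    have hpow : ((m + 1 : ℕ) : ℝ) ^ (3 / 2 : ℝ) = ((m + 1 : ℕ) : ℝ) * √((m + 1 : ℕ) : ℝ) := by
      rw [Real.sqrt_eq_rpow, show (3 / 2 : ℝ) = 1 + 1 / 2 by norm_num, Real.rpow_add hN,
        Real.rpow_one]
    have hτm : τ ^ m ≠ 0 := (pow_pos hτ0 m).ne'
    have hpc : powCoeff b (m + 1) m =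
        psi b τ ^ (m + 1) * (2 * Real.pi)⁻¹ * Q * (J (m + 1)).re / τ ^ m := by
      rw [eq_div_iff hτm, hcr]
    have hsq : (2 * Real.pi)⁻¹ = (√(2 * Real.pi))⁻¹ * (√(2 * Real.pi))⁻¹ := by
      rw [← mul_inv, Real.mul_self_sqrt Real.two_pi_pos.le]
    simp only [Pi.mul_apply]
    rw [lagrangeCoeff, Nat.add_sub_cancel, hpc, hpow, Complex.re_ofReal_mul, div_pow, hsq]
    generalize √(2 * Real.pi) = S at *
    generalize ((m + 1 : ℕ) : ℝ) = N at *
    field_simp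
    ring

end Khinchin

theorem mainTheorem3 (b : ℕ → ℝ) (hb : Khinchin.ClassK b) (hM : 1 < Khinchin.meanLimit b) :
    -- there is exactly one `τ ∈ (0, R)` with `m(τ) = 1`
    ∃ τ : ℝ, (0 < τ ∧ ENNReal.ofReal τ < Khinchin.radius b ∧ Khinchin.mean b τ = 1) ∧
      (∀ t : ℝ, 0 < t → ENNReal.ofReal t < Khinchin.radius b → Khinchin.mean b t = 1 → t = τ) ∧
      -- Lagrange's equation has a solution, and the Taylor coefficients at `0` of every solution
      -- are the numbers `A n`
      ∃ A : ℕ → ℝ,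
        (∃ g : ℂ → ℂ, Khinchin.IsLagrangeSolution b g) ∧
        (∀ g : ℂ → ℂ, Khinchin.IsLagrangeSolution b g →
          HasFPowerSeriesAt g (FormalMultilinearSeries.ofScalars ℂ (fun n => (A n : ℂ))) 0) ∧
        (∀ n : ℕ, ¬ n ≡ 1 [MOD Khinchin.gcdIndex b] → A n = 0) ∧
        A ~[atTop ⊓ 𝓟 {n : ℕ | n ≡ 1 [MOD Khinchin.gcdIndex b]}]
          (fun n : ℕ => (Khinchin.gcdIndex b : ℝ) / √(2 * Real.pi) * (τ / Khinchin.sigma b τ) *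
            (1 / (n : ℝ) ^ (3 / 2 : ℝ)) * (Khinchin.psi b τ / τ) ^ n) := by
  obtain ⟨τ, hτ0, hτ, hm⟩ := Khinchin.exists_mean_eq_one hb hM
  refine ⟨τ, ⟨hτ0, hτ, hm⟩, fun t ht0 ht h => ?_, Khinchin.lagrangeCoeff b,
    Khinchin.exists_isLagrangeSolution hb, fun g hg => hg.hasFPowerSeriesAt hb,
    fun n hn => Khinchin.lagrangeCoeff_eq_zero hn,
    Khinchin.lagrangeCoeff_isEquivalent hb hτ0 hτ hm⟩
  rcases lt_trichotomy t τ with hlt | heq | hlt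
  · exact absurd (Khinchin.mean_lt_mean hb ht0 hlt hτ) (by rw [h, hm]; exact lt_irrefl 1)
  · exact heq
  · exact absurd (Khinchin.mean_lt_mean hb hτ0 hlt ht) (by rw [h, hm]; exact lt_irrefl 1)
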